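/- **Setting.** For a set $A$ of atoms let $V_0(A)=A$, $V_{n+1}(A)=V_n(A)\cup\wp(V_n(A))$ and $V(A)=\bigcup_n V_n(A)$. Let $\kappa$ be a strongly inaccessible cardinal, $\mathbb A$ a set of atoms with $|\mathbb A|=\kappa$, $\Lambda_S$ the family of all sets in $V(\mathbb A)$ with fewer than $\kappa$ elements, $\Lambda=\Lambda_S\cup\mathbb A$, and $\mathfrak L$ the family of all finite sets in $\Lambda$. For a set $T$ let $$\mathfrak F(\mathfrak L,T)=\{\varphi:\mathfrak L\to T\mid \exists X\in\Lambda\ \forall\lambda\in\mathfrak L:\ \varphi(\lambda)=\varphi(\lambda\cap X)\}.$$ Let $\mathbb E_\kappa\subseteq\mathbb A$ be an ordered field with * a numerosity map $\mathfrak{num}:\Lambda_S\to\mathbb E_\kappa$ such that, for $a,b\in\Lambda$ and $A,B,A',B'\in\Lambda_S$: $\mathfrak{num}\{a\}=\mathfrak{num}\{b\}$; $A\subsetneq B$ implies $\mathfrak{num}(A)<\mathfrak{num}(B)$; if $\mathfrak{num}(A)=\mathfrak{num}(A')$ and $\mathfrak{num}(B)=\mathfrak{num}(B')$ then $\mathfrak{num}(A\times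 B)=\mathfrak{num}(A'\times B')$ and, if moreover $A\cap B=A'\cap B'=\varnothing$, $\mathfrak{num}(A\cup B)=\mathfrak{num}(A'\cup B')$; $\mathfrak{num}(A\times\{b\})=\mathfrak{num}(A)$; the field operations satisfy $\mathfrak{num}(A)+\mathfrak{num}(B)=\mathfrak{num}(A\cup B)$ if $A\cap B=\varnothing$, and $\mathfrak{num}(A)\cdot\mathfrak{num}(B)=\mathfrak{num}(A\times B)$; * a choice of a point (center) in each monad $\{\zeta\in\mathbb E_\kappa : |\xi-\zeta|<1/n \text{ for all integers } n\ge 1\}$, such that the centers form an additive subgroup of $\mathbb E_\kappa$ that contains all numerosities; * a $\Lambda$-limit, that is, a surjective ring homomorphism $J:\mathfrak F(\mathfrak L,\mathbb E_\kappa)\to\mathbb E_\kappa$ with $J(\lambda\mapsto|A\cap\lambda|)=\mathfrak{num}(A)$ for all $A\in\Lambda_S$. A statement about $\lambda$ holds *eventually* if it holds on the set of all zeros of some $\psi\in\mathfrak F(\mathfrak L,\mathbb E_\kappa)$ with $J(\psi)=0$. The $\Lambda$-limit of a net $\Phi\in\mathfrak F(\mathfrak L,V_n(\mathbb E_\kappa))$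 is defined by recursion on $n$: if eventually $\Phi(\lambda)\in\mathbb E_\kappa$, then $\lim_{\lambda\uparrow\Lambda}\Phi(\lambda)$ is the value of $J$ on the net of numbers that equals $\Phi(\lambda)$ when $\Phi(\lambda)\in\mathbb E_\kappa$ and $0$ otherwise; if not, it is $$\lim_{\lambda\uparrow\Lambda}\Phi(\lambda)=\Big\{\lim_{\lambda\uparrow\Lambda}\Psi(\lambda)\ \Big|\ \Psi\in\mathfrak F(\mathfrak L,V_{n-1}(\mathbb E_\kappa)),\ \text{eventually }\Psi(\lambda)\in\Phi(\lambda)\Big\}.$$ It does not depend on the choice of $n$. For $x\in V(\mathbb E_\kappa)$, the $*$-transform $x^*\in V(\mathbb E_\kappa)$ is the $\Lambda$-limit of the constant net with value $x$. **Theorem.** The triple $(V(\mathbb E_\kappa),V(\mathbb E_\kappa),*)$ is a superstructure embedding: $*:V(\mathbb E_\kappa)\to V(\mathbb E_\kappa)$ is injective, $(\mathbb E_\kappa)^*=\mathbb E_\kappa$, and $x\in y\Leftrightarrow x^*\in y^*$ for all $x,y\in V(\mathbb E_\kappa)$. Moreover $*$ satisfies the Leibniz principle: for each sentence $P(a_1,\dots,a_k)$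 with constants $a_1,\dots,a_k\in V(\mathbb E_\kappa)$ that is built from formulas $s\in t$ and $s=t$ by connectives and by quantifiers of the form $\forall x\in y$ and $\exists x\in y$, where $y$ is a variable or a constant, $P(a_1,\dots,a_k)$ is true in $V(\mathbb E_\kappa)$ if and only if $P(a_1^*,\dots,a_k^*)$ is true in $V(\mathbb E_\kappa)$. -/

import Mathlib

universe u

open Cardinal

namespace EU

/-! ### The superstructure `V(A)` over a set of atoms `A`

`V_0(A) = A` and `V_{n+1}(A) = V_n(A) ∪ ℘(V_n(A))`. The powersets increase with `n`, hence
`V_{n+1}(A) = A ∪ ℘(V_n(A))`, and this union is disjoint since atoms are not sets. -/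

/-- The `n`-th level `V_n(A)` of the superstructure over the atoms `A`. -/
def Lev (A : Type u) : ℕ → Type u
  | 0 => A
  | n + 1 => A ⊕ Set (Lev A n)

/-- The inclusion of `V_n(A)` in `V_{n+1}(A)`: atoms go to atoms, and a set of elements of
`V_{n-1}(A)` goes to the same set, seen as a set of elements of `V_n(A)`. -/
def lift (A : Type u) : ∀ n, Lev A n → Lev A (n + 1)
  | 0 => fun a => Sum.inl a
  | n + 1 => Sum.map id (Set.image (lift A n))

theorem lift_injective (A : Type u) : ∀ n, Function.Injective (lift A n)
  | 0 => Sum.inl_injective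
  | n + 1 => Sum.map_injective.2
      ⟨Function.injective_id, Set.image_injective.2 (lift_injective A n)⟩

/-- The inclusion of `V_m(A)` in `V_n(A)` for `m ≤ n`. -/
def liftLE (A : Type u) (m n : ℕ) (h : m ≤ n) : Lev A m ↪ Lev A n :=
  ⟨Nat.leRecOn h (fun {k} => lift A k), Nat.leRecOn_injective h _ (lift_injective A)⟩

theorem liftLE_self (A : Type u) (m : ℕ) (x : Lev A m) : liftLE A m m le_rfl x = x :=
  Nat.leRecOn_self x

theorem liftLE_succ (A : Type u) (m n : ℕ) (h : m ≤ n) (x : Lev A m) :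
    liftLE A m (n + 1) (Nat.le_succ_of_le h) x = lift A n (liftLE A m n h x) :=
  Nat.leRecOn_succ h x

instance directedSystem (A : Type u) :
    DirectedSystem (Lev A) (fun m n h => liftLE A m n h) where
  map_self _ x := Nat.leRecOn_self x
  map_map _ _ _ hij hjk x := (Nat.leRecOn_trans hij hjk x).symm

/-- The superstructure `V(A)`, the union of the increasing sequence of the levels `V_n(A)`. -/
abbrev V (A : Type u) : Type u := DirectLimit (Lev A) (liftLE A)

/-- An element of `V_n(A)`, seen as an element of `V(A)`. -/
def V.mk {A : Type u} (n : ℕ) (x : Lev A n) : V A := Quotient.mk _ ⟨n, x⟩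

/-- `V_n(A)` as a subset of `V(A)`. -/
def V.level (A : Type u) (n : ℕ) : Set (V A) := Set.range (V.mk n)

/-- An atom, as an element of `V(A)`. -/
def V.atom {A : Type u} (a : A) : V A := V.mk 0 a

/-- The set whose elements are the members of `s ⊆ V_n(A)`, as an element of `V_{n+1}(A)`. -/
def Lev.ofSet {A : Type u} {n : ℕ} (s : Set (Lev A n)) : Lev A (n + 1) := Sum.inr s

/-- The atom `a`, as an element of `V_{n+1}(A)`. -/
def Lev.ofAtom {A : Type u} (n : ℕ) (a : A) : Lev A (n + 1) := Sum.inl a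

/-- `x ∈ y` for `x ∈ V_n(A)` and `y ∈ V_{n+1}(A)`. -/
def Lev.Mem {A : Type u} {n : ℕ} (x : Lev A n) (y : Lev A (n + 1)) : Prop :=
  ∃ s : Set (Lev A n), y = Lev.ofSet s ∧ x ∈ s

/-- Membership in `V(A)`. Atoms have no elements. -/
def V.Mem {A : Type u} (x y : V A) : Prop :=
  ∃ (n : ℕ) (a : Lev A n) (b : Lev A (n + 1)), x = V.mk n a ∧ y = V.mk (n + 1) b ∧ Lev.Mem a b

instance {A : Type u} : Membership (V A) (V A) := ⟨fun y x => V.Mem x y⟩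

/-- `x` is the set whose elements are exactly the members of `X`. -/
def V.IsSetOf {A : Type u} (x : V A) (X : Set (V A)) : Prop :=
  (∃ (n : ℕ) (s : Set (Lev A n)), x = V.mk (n + 1) (Lev.ofSet s)) ∧ ∀ y, y ∈ x ↔ y ∈ X

/-- The set `A` of all atoms, as an element of `V(A)`. -/
def V.base (A : Type u) : V A := V.mk 1 (Lev.ofSet (n := 0) Set.univ)

/-- `p` is the ordered pair `(a, b) = {{a}, {a, b}}`. -/
def V.IsPair {A : Type u} (p a b : V A) : Prop :=
  ∃ s t, V.IsSetOf s {a} ∧ V.IsSetOf t {a, b} ∧ V.IsSetOf p {s, t}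

/-- The cartesian product `X × Y`. -/
def V.prod {A : Type u} (X Y : Set (V A)) : Set (V A) :=
  {p | ∃ a ∈ X, ∃ b ∈ Y, V.IsPair p a b}

/-! Basic facts about `V(A)`. -/

theorem V.mk_lift {A : Type u} (n : ℕ) (x : Lev A n) : V.mk (n + 1) (lift A n x) = V.mk n x := by
  have e : liftLE A n (n + 1) (Nat.le_succ n) x = lift A n x := Nat.leRecOn_succ' x
  rw [← e]
  exact DirectLimit.mk_apply (f := liftLE A) n (n + 1) x (Nat.le_succ n)

theorem V.mk_liftLE {A : Type u} (m n : ℕ) (h : m ≤ n) (x : Lev A m) :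
    V.mk n (liftLE A m n h x) = V.mk m x :=
  DirectLimit.mk_apply (f := liftLE A) m n x h

theorem V.mk_injective {A : Type u} (n : ℕ) : Function.Injective (V.mk (A := A) n) :=
  DirectLimit.mk_injective (liftLE A) (fun m n h => (liftLE A m n h).injective) n

theorem Lev.ofSet_injective {A : Type u} {n : ℕ} :
    Function.Injective (Lev.ofSet (A := A) (n := n)) := Sum.inr_injective

theorem Lev.mem_ofSet {A : Type u} {n : ℕ} {x : Lev A n} {s : Set (Lev A n)} :
    Lev.Mem x (Lev.ofSet s) ↔ x ∈ s := by
  constructor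
  · rintro ⟨t, h, hx⟩
    rwa [Lev.ofSet_injective h]
  · exact fun h => ⟨s, rfl, h⟩

theorem Lev.mem_lift {A : Type u} {n : ℕ} {x : Lev A (n + 1)} {y : Lev A (n + 1)} :
    Lev.Mem x (lift A (n + 1) y) ↔ ∃ z, x = lift A n z ∧ Lev.Mem z y := by
  constructor
  · rintro ⟨s, h, hx⟩
    rcases y with a | t
    · exact absurd h Sum.inl_ne_inr
    · have e : lift A n '' t = s := Sum.inr_injective h
      subst e
      obtain ⟨z, hz, rfl⟩ := hx
      exact ⟨z, rfl, t, rfl, hz⟩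
  · rintro ⟨z, rfl, t, rfl, hz⟩
    exact ⟨lift A n '' t, rfl, z, hz, rfl⟩

theorem Lev.mem_liftLE {A : Type u} {m n : ℕ} (h : m ≤ n) {x : Lev A n} {y : Lev A (m + 1)} :
    Lev.Mem x (liftLE A (m + 1) (n + 1) (Nat.succ_le_succ h) y) ↔
      ∃ z, x = liftLE A m n h z ∧ Lev.Mem z y := by
  induction n, h using Nat.le_induction with
  | base =>
    rw [liftLE_self]
    constructor
    · exact fun hx => ⟨x, (liftLE_self A m x).symm, hx⟩
    · rintro ⟨z, rfl, hz⟩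
      rwa [liftLE_self]
  | succ n h ih =>
    rw [liftLE_succ A (m + 1) (n + 1) (Nat.succ_le_succ h), Lev.mem_lift]
    constructor
    · rintro ⟨z, rfl, hz⟩
      obtain ⟨w, rfl, hw⟩ := ih.1 hz
      exact ⟨w, (liftLE_succ A m n h w).symm, hw⟩
    · rintro ⟨w, rfl, hw⟩
      exact ⟨liftLE A m n h w, liftLE_succ A m n h w, ih.2 ⟨w, rfl, hw⟩⟩

/-- The elements of a member of `V_{n+1}(A)` lie in `V_n(A)`. -/
theorem V.mem_mk {A : Type u} {n : ℕ} {x : V A} {b : Lev A (n + 1)} :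
    x ∈ V.mk (n + 1) b ↔ ∃ a, x = V.mk n a ∧ Lev.Mem a b := by
  constructor
  · rintro ⟨m, a, c, rfl, hy, hm⟩
    rcases le_total m n with h | h
    · refine ⟨liftLE A m n h a, (V.mk_liftLE m n h a).symm, ?_⟩
      have e : b = liftLE A (m + 1) (n + 1) (Nat.succ_le_succ h) c :=
        V.mk_injective (n + 1) (by rw [V.mk_liftLE, hy])
      rw [e]
      exact (Lev.mem_liftLE h).2 ⟨a, rfl, hm⟩
    · have e : c = liftLE A (n + 1) (m + 1) (Nat.succ_le_succ h) b :=
        V.mk_injective (m + 1) (by rw [V.mk_liftLE, hy])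
      rw [e] at hm
      obtain ⟨z, rfl, hz⟩ := (Lev.mem_liftLE h).1 hm
      exact ⟨z, V.mk_liftLE n m h z, hz⟩
  · rintro ⟨a, rfl, h⟩
    exact ⟨n, a, b, rfl, rfl, h⟩

theorem V.level_mono {A : Type u} {m n : ℕ} (h : m ≤ n) : V.level A m ⊆ V.level A n := by
  rintro _ ⟨x, rfl⟩
  exact ⟨liftLE A m n h x, V.mk_liftLE m n h x⟩

/-- The sets that are elements of `V(A)` are the subsets of `V(A)` contained in some level. -/
theorem V.exists_isSetOf {A : Type u} {X : Set (V A)} :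
    (∃ x, V.IsSetOf x X) ↔ ∃ n, X ⊆ V.level A n := by
  constructor
  · rintro ⟨x, ⟨n, s, rfl⟩, h⟩
    refine ⟨n, fun y hy => ?_⟩
    obtain ⟨a, rfl, -⟩ := V.mem_mk.1 ((h y).2 hy)
    exact ⟨a, rfl⟩
  · rintro ⟨n, h⟩
    refine ⟨V.mk (n + 1) (Lev.ofSet (V.mk n ⁻¹' X)), ⟨n, _, rfl⟩, fun y => ?_⟩
    rw [V.mem_mk]
    constructor
    · rintro ⟨a, rfl, ha⟩
      exact Lev.mem_ofSet.1 ha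
    · intro hy
      obtain ⟨a, rfl⟩ := h hy
      exact ⟨a, rfl, Lev.mem_ofSet.2 hy⟩

/-- Extensionality: a set in `V(A)` is determined by its elements. -/
theorem V.IsSetOf.unique {A : Type u} {x y : V A} {X : Set (V A)} (hx : V.IsSetOf x X)
    (hy : V.IsSetOf y X) : x = y := by
  obtain ⟨⟨m, s, rfl⟩, hx⟩ := hx
  obtain ⟨⟨n, t, rfl⟩, hy⟩ := hy
  wlog h : m ≤ n generalizing m n s t
  · exact (this n t hy m s hx (le_of_not_ge h)).symm
  have key : ∃ s' : Set (Lev A n),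
      liftLE A (m + 1) (n + 1) (Nat.succ_le_succ h) (Lev.ofSet s) = Lev.ofSet s' := by
    clear hx hy
    induction n, h using Nat.le_induction with
    | base => exact ⟨s, Nat.leRecOn_self _⟩
    | succ n h ih =>
      obtain ⟨s', hs'⟩ := ih Set.univ
      refine ⟨lift A n '' s', ?_⟩
      rw [liftLE_succ A (m + 1) (n + 1) (Nat.succ_le_succ h), hs']
      rfl
  obtain ⟨s', hs'⟩ := key
  rw [← V.mk_liftLE (m + 1) (n + 1) (Nat.succ_le_succ h), hs'] at hx ⊢
  congr 2
  ext a
  rw [← Lev.mem_ofSet, ← Lev.mem_ofSet (s := t)]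
  have e : ∀ b : Lev A (n + 1), V.mk n a ∈ V.mk (n + 1) b ↔ Lev.Mem a b := fun b => by
    rw [V.mem_mk]
    exact ⟨fun ⟨c, hc, hm⟩ => V.mk_injective n hc ▸ hm, fun hm => ⟨a, rfl, hm⟩⟩
  rw [← e, ← e, hx, hy]

/-- Every finite subset of `V(A)` is an element of `V(A)`. -/
theorem V.exists_isSetOf_finset {A : Type u} (F : Finset (V A)) :
    ∃ x, V.IsSetOf x (F : Set (V A)) := by
  classical
  rw [V.exists_isSetOf]
  induction F using Finset.induction_on with
  | empty => exact ⟨0, by simp⟩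
  | insert a F _ ih =>
    obtain ⟨n, hn⟩ := ih
    induction a using Quotient.inductionOn with
    | h a =>
      obtain ⟨m, a⟩ := a
      refine ⟨max m n, ?_⟩
      rw [Finset.coe_insert, Set.insert_subset_iff]
      exact ⟨V.level_mono (le_max_left m n) ⟨a, rfl⟩, hn.trans (V.level_mono (le_max_right m n))⟩

/-! ### The accessible universe `Λ` and the nets indexed by its finite sets -/

/-- `Λ_S`: the sets of `V(𝔸)` that have fewer than `κ` elements. -/
def LamS {𝔸 : Type u} (κ : Cardinal.{u}) : Set (Set (V 𝔸)) :=
  {X | (∃ x, V.IsSetOf x X) ∧ #X < κ}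

/-- `Λ = Λ_S ∪ 𝔸`. -/
def Lam {𝔸 : Type u} (κ : Cardinal.{u}) : Set (V 𝔸) :=
  {x | (∃ a, x = V.atom a) ∨ ∃ X ∈ LamS κ, V.IsSetOf x X}

theorem LamS.union {𝔸 : Type u} {κ : Cardinal.{u}} (hκ : ℵ₀ ≤ κ) {X Y : Set (V 𝔸)}
    (hX : X ∈ LamS κ) (hY : Y ∈ LamS κ) : X ∪ Y ∈ LamS κ := by
  obtain ⟨hX, cX⟩ := hX
  obtain ⟨hY, cY⟩ := hY
  refine ⟨?_, (mk_union_le X Y).trans_lt (add_lt_of_lt hκ cX cY)⟩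
  rw [V.exists_isSetOf] at *
  obtain ⟨m, hm⟩ := hX
  obtain ⟨n, hn⟩ := hY
  exact ⟨max m n, Set.union_subset (hm.trans (V.level_mono (le_max_left m n)))
    (hn.trans (V.level_mono (le_max_right m n)))⟩

/-- The finite set `lam ∩ X`. -/
noncomputable def cut {𝔸 : Type u} (lam : Finset (V 𝔸)) (X : Set (V 𝔸)) : Finset (V 𝔸) :=
  open Classical in lam.filter (· ∈ X)

/-- The nets `φ ∈ 𝔉(𝔏, T)`, where `𝔏` is the set of all finite sets of `Λ`: for some set `X` in `Λ`
one has `φ(lam) = φ(lam ∩ X)` for all `lam`. -/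
def IsNet {𝔸 : Type u} (κ : Cardinal.{u}) {T : Type u} (φ : Finset (V 𝔸) → T) : Prop :=
  ∃ X ∈ LamS κ, ∀ lam, φ lam = φ (cut lam X)

/-! ### The Euclidean universe -/

/-- The numerosity axiom, for a map `num` from `Λ_S` to the numbers (its values outside `Λ_S` play
no role). -/
structure NumerosityAxiom {𝔸 : Type u} (κ : Cardinal.{u}) {E : Set 𝔸} [LinearOrder E]
    (num : Set (V 𝔸) → E) : Prop where
  singleton : ∀ a ∈ Lam κ, ∀ b ∈ Lam κ, num {a} = num {b}
  strict_mono : ∀ A ∈ LamS κ, ∀ B ∈ LamS κ, A ⊂ B → num A < num B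
  union : ∀ A ∈ LamS κ, ∀ B ∈ LamS κ, ∀ A' ∈ LamS κ, ∀ B' ∈ LamS κ, A ∩ B = ∅ → A' ∩ B' = ∅ →
    num A = num A' → num B = num B' → num (A ∪ B) = num (A' ∪ B')
  prod : ∀ A ∈ LamS κ, ∀ B ∈ LamS κ, ∀ A' ∈ LamS κ, ∀ B' ∈ LamS κ,
    num A = num A' → num B = num B' → num (V.prod A B) = num (V.prod A' B')
  prod_singleton : ∀ A ∈ LamS κ, ∀ b ∈ Lam κ, num (V.prod A {b}) = num A

/-- The field operations of `E` coincide with the operations on numerosities. -/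
structure FieldAxiom {𝔸 : Type u} (κ : Cardinal.{u}) {E : Set 𝔸} [Field E]
    (num : Set (V 𝔸) → E) : Prop where
  add : ∀ A ∈ LamS κ, ∀ B ∈ LamS κ, A ∩ B = ∅ → num (A ∪ B) = num A + num B
  mul : ∀ A ∈ LamS κ, ∀ B ∈ LamS κ, num (V.prod A B) = num A * num B

/-- `ξ` and `ζ` are infinitely close. -/
def InfClose {𝔸 : Type u} {E : Set 𝔸} [Field E] [LinearOrder E] (ξ ζ : E) : Prop :=
  ∀ n : ℕ, 0 < n → |ξ - ζ| < 1 / (n : E)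

/-- The center axiom: `ctr ξ` is the center of the monad of `ξ`. -/
structure CenterAxiom {𝔸 : Type u} (κ : Cardinal.{u}) {E : Set 𝔸} [Field E] [LinearOrder E]
    (num : Set (V 𝔸) → E) (ctr : E → E) : Prop where
  close : ∀ ξ, InfClose ξ (ctr ξ)
  congr : ∀ ξ ζ, InfClose ξ ζ → ctr ξ = ctr ζ
  subgroup : ∃ C : AddSubgroup E, (C : Set E) = Set.range ctr ∧ ∀ A ∈ LamS κ, num A ∈ C

/-- `E ⊆ 𝔸` is a Euclidean field over the set of atoms `𝔸`, whose cardinality is the strongly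
inaccessible cardinal `κ`. -/
structure IsEuclidean {𝔸 : Type u} (κ : Cardinal.{u}) (E : Set 𝔸) [Field E] [LinearOrder E]
    (num : Set (V 𝔸) → E) (ctr : E → E) : Prop where
  inaccessible : κ.IsInaccessible
  card_atoms : #𝔸 = κ
  numerosity : NumerosityAxiom κ num
  field : FieldAxiom κ num
  center : CenterAxiom κ num ctr

/-- `J` is a `Λ`-limit: a homomorphism of rings of `𝔉(𝔏, E)` onto `E` which maps the net
`lam ↦ |A ∩ lam|` to the numerosity of `A` (its values on functions that are not in `𝔉(𝔏, E)` play
no role). -/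
structure IsLambdaLimit {𝔸 : Type u} (κ : Cardinal.{u}) {E : Set 𝔸} [Field E]
    (num : Set (V 𝔸) → E) (J : (Finset (V 𝔸) → E) → E) : Prop where
  map_one : J (fun _ => 1) = 1
  map_add : ∀ φ ψ, IsNet κ φ → IsNet κ ψ → J (fun lam => φ lam + ψ lam) = J φ + J ψ
  map_mul : ∀ φ ψ, IsNet κ φ → IsNet κ ψ → J (fun lam => φ lam * ψ lam) = J φ * J ψ
  map_count : ∀ A ∈ LamS κ, J (fun lam => ((cut lam A).card : E)) = num A
  onto : ∀ ξ, ∃ φ, IsNet κ φ ∧ J φ = ξ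

/-! ### The `Λ`-limit of nets in `V_n(E)` and the `*`-transform -/

section Limit

variable {𝔸 : Type u} (κ : Cardinal.{u}) {E : Set 𝔸} [Field E] (J : (Finset (V 𝔸) → E) → E)

/-- `P` holds on a qualified set: on the set of all zeros of some net of numbers with limit `0`. -/
def Eventually (P : Finset (V 𝔸) → Prop) : Prop :=
  ∃ ψ : Finset (V 𝔸) → E, IsNet κ ψ ∧ J ψ = 0 ∧ ∀ lam, ψ lam = 0 → P lam

/-- `x` is an atom. -/
def Lev.IsAtom {n : ℕ} (x : Lev E (n + 1)) : Prop := ∃ a : E, x = Lev.ofAtom n a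

/-- The number that `x` is, and `0` if `x` is a set. -/
def Lev.toAtom {n : ℕ} (x : Lev E (n + 1)) : E := Sum.elim (fun a => a) (fun _ => 0) x

/-- The `Λ`-limit of a net in `V_n(E)`, by recursion on `n`. If `Φ` is eventually a net of numbers
then it is the limit of this net of numbers, and otherwise it is the set of the limits of all the
nets `Ψ` in `V_{n-1}(E)` for which eventually `Ψ lam ∈ Φ lam`. -/
noncomputable def lim : (n : ℕ) → (Finset (V 𝔸) → Lev E n) → Lev E n
  | 0, Φ => J Φ
  | n + 1, Φ =>
    open Classical in
    if Eventually κ J (fun lam => Lev.IsAtom (Φ lam)) then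
      Lev.ofAtom n (J fun lam => Lev.toAtom (Φ lam))
    else
      Lev.ofSet {x | ∃ Ψ : Finset (V 𝔸) → Lev E n,
        IsNet κ Ψ ∧ Eventually κ J (fun lam => Lev.Mem (Ψ lam) (Φ lam)) ∧ x = lim n Ψ}

end Limit

/-! The `Λ`-limit does not depend on the level at which the net is considered. -/

theorem IsNet.comp {𝔸 : Type u} {κ : Cardinal.{u}} {S T : Type u} {φ : Finset (V 𝔸) → S}
    (h : IsNet κ φ) (g : S → T) : IsNet κ (fun lam => g (φ lam)) := by
  obtain ⟨X, hX, h⟩ := h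
  exact ⟨X, hX, fun lam => congrArg g (h lam)⟩

theorem IsNet.comp₂ {𝔸 : Type u} {κ : Cardinal.{u}} (hκ : ℵ₀ ≤ κ) {R S T : Type u}
    {φ : Finset (V 𝔸) → R} {ψ : Finset (V 𝔸) → S} (hφ : IsNet κ φ) (hψ : IsNet κ ψ)
    (g : R → S → T) : IsNet κ (fun lam => g (φ lam) (ψ lam)) := by
  obtain ⟨X, hX, hφ⟩ := hφ
  obtain ⟨Y, hY, hψ⟩ := hψ
  refine ⟨X ∪ Y, LamS.union hκ hX hY, fun lam => ?_⟩
  have e : cut (cut lam (X ∪ Y)) X = cut lam X ∧ cut (cut lam (X ∪ Y)) Y = cut lam Y := by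
    constructor <;> ext x <;> simp only [cut, Finset.mem_filter, Set.mem_union] <;> tauto
  have e1 : φ (cut lam (X ∪ Y)) = φ lam := by rw [hφ (cut lam (X ∪ Y)), e.1, ← hφ]
  have e2 : ψ (cut lam (X ∪ Y)) = ψ lam := by rw [hψ (cut lam (X ∪ Y)), e.2, ← hψ]
  simp only [e1, e2]

theorem IsNet.const {𝔸 : Type u} {κ : Cardinal.{u}} (hκ : ℵ₀ ≤ κ) {T : Type u} (t : T) :
    IsNet κ (fun _ : Finset (V 𝔸) => t) :=
  ⟨∅, ⟨V.exists_isSetOf.2 ⟨0, Set.empty_subset _⟩, by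
    simpa using aleph0_pos.trans_le hκ⟩, fun _ => rfl⟩

section Compat

variable {𝔸 : Type u} {κ : Cardinal.{u}} {E : Set 𝔸} [Field E] {num : Set (V 𝔸) → E}
  {J : (Finset (V 𝔸) → E) → E}

theorem Eventually.mono {P Q : Finset (V 𝔸) → Prop} (h : Eventually κ J P)
    (hPQ : ∀ lam, P lam → Q lam) : Eventually κ J Q := by
  obtain ⟨ψ, hψ, h0, h⟩ := h
  exact ⟨ψ, hψ, h0, fun lam hl => hPQ lam (h lam hl)⟩

theorem IsLambdaLimit.map_zero (hκ : ℵ₀ ≤ κ) (hJ : IsLambdaLimit κ num J) :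
    J (fun _ => 0) = 0 := by
  have h := hJ.map_add (fun _ => 0) (fun _ => 0) (IsNet.const hκ 0) (IsNet.const hκ 0)
  simpa using h

theorem Eventually.of_forall (hκ : ℵ₀ ≤ κ) (hJ : IsLambdaLimit κ num J)
    {P : Finset (V 𝔸) → Prop} (h : ∀ lam, P lam) : Eventually κ J P :=
  ⟨fun _ => 0, IsNet.const hκ 0, hJ.map_zero hκ, fun lam _ => h lam⟩

theorem Eventually.and [LinearOrder E] [IsStrictOrderedRing E] (hκ : ℵ₀ ≤ κ)
    (hJ : IsLambdaLimit κ num J) {P Q : Finset (V 𝔸) → Prop} (hP : Eventually κ J P)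
    (hQ : Eventually κ J Q) : Eventually κ J (fun lam => P lam ∧ Q lam) := by
  obtain ⟨φ, nφ, φ0, hφ⟩ := hP
  obtain ⟨ψ, nψ, ψ0, hψ⟩ := hQ
  refine ⟨fun lam => φ lam * φ lam + ψ lam * ψ lam,
    nφ.comp₂ hκ nψ (fun a b => a * a + b * b), ?_, fun lam hl => ?_⟩
  · rw [hJ.map_add _ _ (nφ.comp fun a => a * a) (nψ.comp fun a => a * a),
      hJ.map_mul _ _ nφ nφ, hJ.map_mul _ _ nψ nψ, φ0, ψ0]
    simp
  · have h := (mul_self_add_mul_self_eq_zero (a := φ lam) (b := ψ lam)).1 hl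
    exact ⟨hφ lam h.1, hψ lam h.2⟩

theorem IsLambdaLimit.congr (hκ : ℵ₀ ≤ κ) (hJ : IsLambdaLimit κ num J)
    {φ ψ : Finset (V 𝔸) → E} (hφ : IsNet κ φ) (hψ : IsNet κ ψ)
    (h : Eventually κ J (fun lam => φ lam = ψ lam)) : J φ = J ψ := by
  obtain ⟨θ, nθ, θ0, h⟩ := h
  have nq : IsNet κ (fun lam => (φ lam - ψ lam) / θ lam) :=
    (hφ.comp₂ hκ hψ (fun a b => a - b)).comp₂ hκ nθ (fun a b => a / b)
  have e : φ = fun lam => ψ lam + θ lam * ((φ lam - ψ lam) / θ lam) := by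
    funext lam
    by_cases h0 : θ lam = 0
    · simp [h0, h lam h0]
    · field_simp
      ring
  rw [e, hJ.map_add _ _ hψ (nθ.comp₂ hκ nq (fun a b => a * b)), hJ.map_mul _ _ nθ nq, θ0]
  simp

theorem lim_of_atom {n : ℕ} {Φ : Finset (V 𝔸) → Lev E (n + 1)}
    (h : Eventually κ J (fun lam => Lev.IsAtom (Φ lam))) :
    lim κ J (n + 1) Φ = Lev.ofAtom n (J fun lam => Lev.toAtom (Φ lam)) :=
  if_pos h

theorem lim_of_not_atom {n : ℕ} {Φ : Finset (V 𝔸) → Lev E (n + 1)}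
    (h : ¬ Eventually κ J (fun lam => Lev.IsAtom (Φ lam))) :
    lim κ J (n + 1) Φ = Lev.ofSet {x | ∃ Ψ : Finset (V 𝔸) → Lev E n,
      IsNet κ Ψ ∧ Eventually κ J (fun lam => Lev.Mem (Ψ lam) (Φ lam)) ∧ x = lim κ J n Ψ} :=
  if_neg h

variable [LinearOrder E] [IsStrictOrderedRing E]

theorem lim_congr (hκ : ℵ₀ ≤ κ) (hJ : IsLambdaLimit κ num J) (n : ℕ)
    {Φ Φ' : Finset (V 𝔸) → Lev E n} (hΦ : IsNet κ Φ) (hΦ' : IsNet κ Φ')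
    (h : Eventually κ J (fun lam => Φ lam = Φ' lam)) : lim κ J n Φ = lim κ J n Φ' := by
  cases n with
  | zero => exact hJ.congr hκ hΦ hΦ' h
  | succ n =>
    have key : ∀ P : Lev E (n + 1) → Finset (V 𝔸) → Prop,
        Eventually κ J (fun lam => P (Φ lam) lam) ↔ Eventually κ J (fun lam => P (Φ' lam) lam) :=
      fun P => ⟨fun hP => (hP.and hκ hJ h).mono fun lam hl => hl.2 ▸ hl.1,
        fun hP => (hP.and hκ hJ h).mono fun lam hl => hl.2.symm ▸ hl.1⟩
    have e1 := key (fun x _ => Lev.IsAtom x)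
    have e2 : J (fun lam => Lev.toAtom (Φ lam)) = J (fun lam => Lev.toAtom (Φ' lam)) :=
      hJ.congr hκ (hΦ.comp Lev.toAtom) (hΦ'.comp Lev.toAtom)
        (h.mono fun lam hl => congrArg Lev.toAtom hl)
    by_cases ha : Eventually κ J (fun lam => Lev.IsAtom (Φ lam))
    · rw [lim_of_atom ha, lim_of_atom (e1.1 ha), e2]
    · rw [lim_of_not_atom ha, lim_of_not_atom (fun h' => ha (e1.2 h'))]
      refine congrArg Lev.ofSet (Set.ext fun x => ?_)
      simp only [Set.mem_ofPred_eq]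
      exact exists_congr fun Ψ => by rw [key (fun y lam => Lev.Mem (Ψ lam) y)]

theorem lim_lift (hκ : ℵ₀ ≤ κ) (hJ : IsLambdaLimit κ num J) : ∀ (n : ℕ)
    {Φ : Finset (V 𝔸) → Lev E n}, IsNet κ Φ →
      lim κ J (n + 1) (fun lam => lift E n (Φ lam)) = lift E n (lim κ J n Φ)
  | 0, Φ, _ => by
    have h : Eventually κ J (fun lam => Lev.IsAtom (lift E 0 (Φ lam))) :=
      Eventually.of_forall hκ hJ fun lam => ⟨Φ lam, rfl⟩
    rw [lim_of_atom h]
    rfl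
  | n + 1, Φ, hΦ => by
    have e1 : ∀ x : Lev E (n + 1), Lev.IsAtom (lift E (n + 1) x) ↔ Lev.IsAtom x := by
      rintro (a | s)
      · exact ⟨fun _ => ⟨a, rfl⟩, fun _ => ⟨a, rfl⟩⟩
      · exact ⟨fun ⟨a, h⟩ => absurd h Sum.inr_ne_inl, fun ⟨a, h⟩ => absurd h Sum.inr_ne_inl⟩
    have e2 : ∀ x : Lev E (n + 1), Lev.toAtom (lift E (n + 1) x) = Lev.toAtom x := by
      rintro (a | s) <;> rfl
    by_cases h : Eventually κ J (fun lam => Lev.IsAtom (Φ lam))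
    · rw [lim_of_atom h, lim_of_atom (h.mono fun lam => (e1 (Φ lam)).2)]
      simp only [e2]
      rfl
    · rw [lim_of_not_atom h, lim_of_not_atom fun h' => h (h'.mono fun lam => (e1 (Φ lam)).1)]
      change Lev.ofSet _ = Lev.ofSet (lift E n '' _)
      refine congrArg Lev.ofSet (Set.ext fun x => ?_)
      simp only [Set.mem_ofPred_eq, Set.mem_image]
      constructor
      · rintro ⟨Ψ, hΨ, hm, rfl⟩
        have hne : Nonempty (Lev E n) := by
          cases n with
          | zero => exact ⟨(0 : E)⟩
          | succ n => exact ⟨Lev.ofAtom n (0 : E)⟩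
        have hg := Function.leftInverse_invFun (lift_injective E n)
        have nΨ' : IsNet κ (fun lam => Function.invFun (lift E n) (Ψ lam)) := hΨ.comp _
        refine ⟨lim κ J n fun lam => Function.invFun (lift E n) (Ψ lam), ⟨_, nΨ', ?_, rfl⟩, ?_⟩
        · refine hm.mono fun lam hl => ?_
          obtain ⟨z, hz, hzm⟩ := Lev.mem_lift.1 hl
          rw [hz, hg z]
          exact hzm
        · rw [← lim_lift hκ hJ n nΨ']
          refine lim_congr hκ hJ (n + 1) (nΨ'.comp (lift E n)) hΨ (hm.mono fun lam hl => ?_)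
          obtain ⟨z, hz, hzm⟩ := Lev.mem_lift.1 hl
          rw [hz, hg z]
      · rintro ⟨y, ⟨Ψ, hΨ, hm, rfl⟩, rfl⟩
        exact ⟨fun lam => lift E n (Ψ lam), hΨ.comp _,
          hm.mono fun lam hl => Lev.mem_lift.2 ⟨_, rfl, hl⟩, (lim_lift hκ hJ n hΨ).symm⟩

theorem lim_liftLE (hκ : ℵ₀ ≤ κ) (hJ : IsLambdaLimit κ num J) (m n : ℕ) (h : m ≤ n)
    {Φ : Finset (V 𝔸) → Lev E m} (hΦ : IsNet κ Φ) :
    lim κ J n (fun lam => liftLE E m n h (Φ lam)) = liftLE E m n h (lim κ J m Φ) := by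
  induction n, h using Nat.le_induction with
  | base => simp only [liftLE_self]
  | succ n h ih =>
    rw [liftLE_succ E m n h, ← ih, ← lim_lift hκ hJ n (hΦ.comp (liftLE E m n h))]
    simp only [liftLE_succ E m n h]

end Compat

/-- The `*`-transform `x ↦ x*` on `V(E)`: the `Λ`-limit of the constant net with value `x`. -/
noncomputable def star {𝔸 : Type u} {κ : Cardinal.{u}} {E : Set 𝔸} [Field E] [LinearOrder E]
    [IsStrictOrderedRing E] {num : Set (V 𝔸) → E} {ctr : E → E} {J : (Finset (V 𝔸) → E) → E}
    (hE : IsEuclidean κ E num ctr) (hJ : IsLambdaLimit κ num J) : V E → V E :=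
  DirectLimit.lift (liftLE E) (fun n x => V.mk n (lim κ J n (fun _ => x))) fun m n h x => by
    have hκ : ℵ₀ ≤ κ := hE.inaccessible.aleph0_lt.le
    rw [lim_liftLE hκ hJ m n h (IsNet.const hκ x), V.mk_liftLE]

/-! ### Superstructure embeddings and the Leibniz principle -/

/-- The map `f` from `V(A)` to `V(S)` is a superstructure embedding. -/
structure IsSuperstructureEmbedding {A S : Type u} (f : V A → V S) : Prop where
  injective : Function.Injective f
  map_base : f (V.base A) = V.base S
  mem_iff : ∀ x y, x ∈ y ↔ f x ∈ f y

/-- Terms with constants in `C` and `n` free variables. -/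
inductive ElemTerm (C : Type u) (n : ℕ) : Type u
  | const (c : C) : ElemTerm C n
  | var (i : Fin n) : ElemTerm C n

/-- Elementary formulas with constants in `C` and `n` free variables: all quantifiers are of the
form `∀ x ∈ t` or `∃ x ∈ t`, where `t` is a constant or one of the `n` variables. In `all t φ` and
`ex t φ` the bound variable is the variable `0` of `φ`, and the other variables of `φ` are shifted
by one. -/
inductive ElemFormula (C : Type u) : ℕ → Type u
  | eq {n : ℕ} (s t : ElemTerm C n) : ElemFormula C n
  | mem {n : ℕ} (s t : ElemTerm C n) : ElemFormula C n
  | not {n : ℕ} (φ : ElemFormula C n) : ElemFormula C n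
  | and {n : ℕ} (φ ψ : ElemFormula C n) : ElemFormula C n
  | or {n : ℕ} (φ ψ : ElemFormula C n) : ElemFormula C n
  | imp {n : ℕ} (φ ψ : ElemFormula C n) : ElemFormula C n
  | all {n : ℕ} (t : ElemTerm C n) (φ : ElemFormula C (n + 1)) : ElemFormula C n
  | ex {n : ℕ} (t : ElemTerm C n) (φ : ElemFormula C (n + 1)) : ElemFormula C n

/-- The replacement of each constant `c` of a term by `f c`. -/
def ElemTerm.map {C D : Type u} (f : C → D) {n : ℕ} : ElemTerm C n → ElemTerm D n
  | const c => const (f c)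
  | var i => var i

/-- The replacement of each constant `c` of a formula by `f c`. -/
def ElemFormula.map {C D : Type u} (f : C → D) : {n : ℕ} → ElemFormula C n → ElemFormula D n
  | _, eq s t => eq (s.map f) (t.map f)
  | _, mem s t => mem (s.map f) (t.map f)
  | _, not φ => not (φ.map f)
  | _, and φ ψ => and (φ.map f) (ψ.map f)
  | _, or φ ψ => or (φ.map f) (ψ.map f)
  | _, imp φ ψ => imp (φ.map f) (ψ.map f)
  | _, all t φ => all (t.map f) (φ.map f)
  | _, ex t φ => ex (t.map f) (φ.map f)

/-- The value of a term in `V(A)`, under the assignment `v` of the variables. -/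
def ElemTerm.val {A : Type u} {n : ℕ} (v : Fin n → V A) : ElemTerm (V A) n → V A
  | const c => c
  | var i => v i

/-- The truth of a formula in `V(A)`, under the assignment `v` of the free variables. -/
def ElemFormula.Holds {A : Type u} : {n : ℕ} → ElemFormula (V A) n → (Fin n → V A) → Prop
  | _, eq s t, v => s.val v = t.val v
  | _, mem s t, v => s.val v ∈ t.val v
  | _, not φ, v => ¬ φ.Holds v
  | _, and φ ψ, v => φ.Holds v ∧ ψ.Holds v
  | _, or φ ψ, v => φ.Holds v ∨ ψ.Holds v
  | _, imp φ ψ, v => φ.Holds v → ψ.Holds v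
  | _, all t φ, v => ∀ x, x ∈ t.val v → φ.Holds (Fin.cons x v)
  | _, ex t φ, v => ∃ x, x ∈ t.val v ∧ φ.Holds (Fin.cons x v)

/-- The Leibniz principle for `f`: an elementary sentence with constants `a_1, …, a_k` in `V(A)` is
true in `V(A)` if and only if the sentence with the constants `f a_1, …, f a_k` is true in
`V(S)`. -/
def LeibnizPrinciple {A S : Type u} (f : V A → V S) : Prop :=
  ∀ φ : ElemFormula (V A) 0, φ.Holds Fin.elim0 ↔ (φ.map f).Holds Fin.elim0

end EU

/-!
The `Λ`-limit is an ultrapower construction in disguise. Since `J` is a homomorphism into a field,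
the indicator net of a predicate that depends on `lam` through a net has limit `0` or `1`; hence
such a predicate or its negation holds eventually. They never do both, since a net of numbers
without zeros is invertible and has a nonzero limit (`IsNet.eventually_not_iff`). So *eventually*
behaves as an ultrafilter on these predicates. Moreover nets can be composed with arbitrary
functions, in particular with choice functions, and so an existential statement that holds
eventually is witnessed by a net (`IsNet.eventually_exists_iff`).

From these two facts, induction on the level shows that two nets in `V_n(E)` have the same limit
exactly if they are eventually equal (`lim_eq_iff`): if two nets of sets are not eventually equal,
then eventually one has an element outside the other, and the limit of a net of such elements
separates the two limits. Consequently the limit of `Ψ` belongs to the limit of `Φ` exactly if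
eventually `Ψ lam ∈ Φ lam` (`lim_mem_iff`), and the elements of a limit are again limits.

These are the atomic cases and the quantifier step of Łoś's theorem
(`holds_map_star_iff`): an elementary formula holds of limits exactly if it holds eventually along
the nets. Only bounded quantifiers are treated, and they are what is needed for the bound variable
to range over limits. For sentences no net is left but the constants, and Łoś's theorem becomes the
Leibniz principle. The equality `E* = E` is the surjectivity of `J`.
-/

namespace EU

/-! ### Levels of the superstructure -/

section Levels

variable {𝔸 : Type u} {E : Set 𝔸}

theorem V.mk_mem_mk {A : Type u} {n : ℕ} {a : Lev A n} {b : Lev A (n + 1)} :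
    V.mk n a ∈ V.mk (n + 1) b ↔ Lev.Mem a b := by
  rw [V.mem_mk]
  exact ⟨fun ⟨c, hc, hm⟩ => V.mk_injective n hc ▸ hm, fun hm => ⟨a, rfl, hm⟩⟩

theorem Lev.ofAtom_ne_ofSet {A : Type u} {n : ℕ} (a : A) (s : Set (Lev A n)) :
    Lev.ofAtom n a ≠ Lev.ofSet s := Sum.inl_ne_inr

theorem Lev.Mem.not_isAtom {n : ℕ} {x : Lev E n} {y : Lev E (n + 1)} (h : Lev.Mem x y) :
    ¬ Lev.IsAtom y := by
  rintro ⟨a, rfl⟩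
  obtain ⟨s, hs, -⟩ := h
  exact Lev.ofAtom_ne_ofSet a s hs

theorem Lev.exists_mem_of_ne {n : ℕ} {x y : Lev E (n + 1)} (hx : ¬ Lev.IsAtom x)
    (hy : ¬ Lev.IsAtom y) (h : x ≠ y) :
    (∃ z, Lev.Mem z x ∧ ¬ Lev.Mem z y) ∨ ∃ z, Lev.Mem z y ∧ ¬ Lev.Mem z x := by
  rcases x with a | s
  · exact absurd ⟨a, rfl⟩ hx
  rcases y with a | t
  · exact absurd ⟨a, rfl⟩ hy
  by_contra! hc
  refine h (congrArg Sum.inr (Set.ext fun z => ?_))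
  exact ⟨fun hz => Lev.mem_ofSet.1 (hc.1 z (Lev.mem_ofSet.2 hz)),
    fun hz => Lev.mem_ofSet.1 (hc.2 z (Lev.mem_ofSet.2 hz))⟩

end Levels

section Los

variable {𝔸 : Type u} {κ : Cardinal.{u}} {E : Set 𝔸} [Field E] {num : Set (V 𝔸) → E}
  {J : (Finset (V 𝔸) → E) → E}

/-! ### Eventual truth as an ultrafilter -/

/-- A net without zeros has a multiplicative inverse, hence a nonzero limit. -/
theorem not_eventually_false (hJ : IsLambdaLimit κ num J) :
    ¬ Eventually κ J (fun _ => False) := by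
  rintro ⟨ψ, nψ, ψ0, h⟩
  have e : (fun lam => ψ lam * (ψ lam)⁻¹) = fun _ => 1 :=
    funext fun lam => mul_inv_cancel₀ (h lam)
  have h1 := hJ.map_mul ψ (fun lam => (ψ lam)⁻¹) nψ (nψ.comp fun a => a⁻¹)
  rw [e, hJ.map_one, ψ0, zero_mul] at h1
  exact one_ne_zero h1

theorem IsNet.eventually_or_eventually_not (hκ : ℵ₀ ≤ κ) (hJ : IsLambdaLimit κ num J) {T : Type u}
    {φ : Finset (V 𝔸) → T} (hφ : IsNet κ φ) (P : T → Prop) :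
    Eventually κ J (fun lam => P (φ lam)) ∨ Eventually κ J (fun lam => ¬ P (φ lam)) := by
  classical
  have n1 : IsNet κ (fun lam => if P (φ lam) then (1 : E) else 0) :=
    hφ.comp fun t => if P t then (1 : E) else 0
  have n2 : IsNet κ (fun lam => if P (φ lam) then (0 : E) else 1) :=
    hφ.comp fun t => if P t then (0 : E) else 1
  -- The indicator nets of `P` and of its negation have product `0`, so one of them has limit `0`.
  have h := hJ.map_mul _ _ n1 n2
  have e : (fun lam => (if P (φ lam) then (1 : E) else 0) * (if P (φ lam) then (0 : E) else 1)) =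
      fun _ => 0 := by
    funext lam
    split_ifs <;> simp
  rw [e, hJ.map_zero hκ] at h
  rcases mul_eq_zero.1 h.symm with h | h
  · exact Or.inr ⟨_, n1, h, fun lam hl hP => by simp [hP] at hl⟩
  · exact Or.inl ⟨_, n2, h, fun lam hl => by_contra fun hP => by simp [hP] at hl⟩

theorem eventually_const_iff (hκ : ℵ₀ ≤ κ) (hJ : IsLambdaLimit κ num J) {P : Prop} :
    Eventually κ J (fun _ => P) ↔ P :=
  ⟨fun h => by_contra fun hP => not_eventually_false hJ (h.mono fun _ => hP),
    fun h => Eventually.of_forall hκ hJ fun _ => h⟩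

theorem IsLambdaLimit.eventually_eq (hκ : ℵ₀ ≤ κ) (hJ : IsLambdaLimit κ num J)
    {φ ψ : Finset (V 𝔸) → E} (hφ : IsNet κ φ) (hψ : IsNet κ ψ) (h : J φ = J ψ) :
    Eventually κ J (fun lam => φ lam = ψ lam) := by
  have nd : IsNet κ (fun lam => φ lam - ψ lam) := hφ.comp₂ hκ hψ fun a b => a - b
  refine ⟨_, nd, ?_, fun lam hl => sub_eq_zero.1 hl⟩
  have e := hJ.map_add _ _ nd hψ
  simp only [sub_add_cancel] at e
  exact right_eq_add.1 (h.symm.trans e)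

/-- A choice function composed with a net is a net, so that existential statements have witnesses
among the nets. -/
theorem IsNet.eventually_exists_iff {T S : Type u} [Nonempty S] {φ : Finset (V 𝔸) → T}
    (hφ : IsNet κ φ) (R : T → S → Prop) :
    Eventually κ J (fun lam => ∃ x, R (φ lam) x) ↔
      ∃ ψ : Finset (V 𝔸) → S, IsNet κ ψ ∧ Eventually κ J (fun lam => R (φ lam) (ψ lam)) :=
  ⟨fun h => ⟨_, hφ.comp fun t => Classical.epsilon (R t),
    h.mono fun _ hl => Classical.epsilon_spec hl⟩,
    fun ⟨ψ, _, h⟩ => h.mono fun lam hl => ⟨ψ lam, hl⟩⟩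

instance Lev.instNonempty : ∀ n, Nonempty (Lev E n)
  | 0 => ⟨(0 : E)⟩
  | n + 1 => ⟨Lev.ofAtom n (0 : E)⟩

section Ordered

variable [LinearOrder E] [IsStrictOrderedRing E]

theorem IsNet.eventually_not_iff (hκ : ℵ₀ ≤ κ) (hJ : IsLambdaLimit κ num J) {T : Type u}
    {φ : Finset (V 𝔸) → T} (hφ : IsNet κ φ) (P : T → Prop) :
    Eventually κ J (fun lam => ¬ P (φ lam)) ↔ ¬ Eventually κ J (fun lam => P (φ lam)) :=
  ⟨fun h h' => not_eventually_false hJ ((h'.and hκ hJ h).mono fun _ hl => hl.2 hl.1),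
    (hφ.eventually_or_eventually_not hκ hJ P).resolve_left⟩

theorem eventually_and_iff (hκ : ℵ₀ ≤ κ) (hJ : IsLambdaLimit κ num J)
    {P Q : Finset (V 𝔸) → Prop} :
    Eventually κ J (fun lam => P lam ∧ Q lam) ↔ Eventually κ J P ∧ Eventually κ J Q :=
  ⟨fun h => ⟨h.mono fun _ hl => hl.1, h.mono fun _ hl => hl.2⟩, fun h => h.1.and hκ hJ h.2⟩

theorem IsNet.eventually_imp_iff (hκ : ℵ₀ ≤ κ) (hJ : IsLambdaLimit κ num J) {T : Type u}
    {φ : Finset (V 𝔸) → T} (hφ : IsNet κ φ) (P Q : T → Prop) :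
    Eventually κ J (fun lam => P (φ lam) → Q (φ lam)) ↔
      (Eventually κ J (fun lam => P (φ lam)) → Eventually κ J (fun lam => Q (φ lam))) := by
  constructor
  · exact fun h hP => (h.and hκ hJ hP).mono fun _ hl => hl.1 hl.2
  · intro h
    rcases hφ.eventually_or_eventually_not hκ hJ P with hP | hP
    · exact (h hP).mono fun _ hl _ => hl
    · exact hP.mono fun _ hl hl' => absurd hl' hl

theorem IsNet.eventually_or_iff (hκ : ℵ₀ ≤ κ) (hJ : IsLambdaLimit κ num J) {T : Type u}
    {φ : Finset (V 𝔸) → T} (hφ : IsNet κ φ) (P Q : T → Prop) :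
    Eventually κ J (fun lam => P (φ lam) ∨ Q (φ lam)) ↔
      Eventually κ J (fun lam => P (φ lam)) ∨ Eventually κ J (fun lam => Q (φ lam)) := by
  simp only [or_iff_not_imp_left]
  rw [hφ.eventually_imp_iff hκ hJ (fun t => ¬ P t) Q, hφ.eventually_not_iff hκ hJ P]

/-! ### Equality and membership of limits -/

/-- The elements of the limit of a net are the limits of the nets that are eventually elements of
it. This also covers nets of numbers, where both sides are false. -/
theorem mem_lim_iff (hκ : ℵ₀ ≤ κ) (hJ : IsLambdaLimit κ num J) {n : ℕ}
    {Φ : Finset (V 𝔸) → Lev E (n + 1)} {x : Lev E n} :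
    Lev.Mem x (lim κ J (n + 1) Φ) ↔ ∃ Ψ : Finset (V 𝔸) → Lev E n, IsNet κ Ψ ∧
      Eventually κ J (fun lam => Lev.Mem (Ψ lam) (Φ lam)) ∧ x = lim κ J n Ψ := by
  by_cases ha : Eventually κ J (fun lam => Lev.IsAtom (Φ lam))
  · rw [lim_of_atom ha]
    refine ⟨fun h => absurd ⟨_, rfl⟩ h.not_isAtom, fun ⟨Ψ, _, hΨ, _⟩ => ?_⟩
    exact absurd ((ha.and hκ hJ hΨ).mono fun _ hl => hl.2.not_isAtom hl.1)
      (not_eventually_false hJ)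
  · rw [lim_of_not_atom ha]
    exact Lev.mem_ofSet

theorem eventually_eq_of_lim_eq (hκ : ℵ₀ ≤ κ) (hJ : IsLambdaLimit κ num J) : ∀ (n : ℕ)
    {Φ Ψ : Finset (V 𝔸) → Lev E n}, IsNet κ Φ → IsNet κ Ψ → lim κ J n Φ = lim κ J n Ψ →
      Eventually κ J (fun lam => Φ lam = Ψ lam)
  | 0, _, _, hΦ, hΨ, h => hJ.eventually_eq hκ hΦ hΨ h
  | n + 1, Φ, Ψ, hΦ, hΨ, h => by
    by_cases ha : Eventually κ J (fun lam => Lev.IsAtom (Φ lam)) <;>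
      by_cases hb : Eventually κ J (fun lam => Lev.IsAtom (Ψ lam))
    · rw [lim_of_atom ha, lim_of_atom hb] at h
      have e := eventually_eq_of_lim_eq hκ hJ 0 (hΦ.comp Lev.toAtom) (hΨ.comp Lev.toAtom)
        (Sum.inl_injective h)
      refine ((ha.and hκ hJ hb).and hκ hJ e).mono ?_
      rintro lam ⟨⟨⟨a, ha⟩, ⟨b, hb⟩⟩, hl⟩
      rw [ha, hb] at hl ⊢
      exact congrArg (Lev.ofAtom n) hl
    · rw [lim_of_atom ha, lim_of_not_atom hb] at h
      exact absurd h (Lev.ofAtom_ne_ofSet _ _)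
    · rw [lim_of_not_atom ha, lim_of_atom hb] at h
      exact absurd h.symm (Lev.ofAtom_ne_ofSet _ _)
    · -- A net that is eventually in `Φ` and not in `Ψ` has a limit in exactly one of the limits.
      have key : ∀ {Φ Ψ : Finset (V 𝔸) → Lev E (n + 1)}, IsNet κ Φ → IsNet κ Ψ →
          lim κ J (n + 1) Φ = lim κ J (n + 1) Ψ →
          ¬ Eventually κ J (fun lam => ∃ z, Lev.Mem z (Φ lam) ∧ ¬ Lev.Mem z (Ψ lam)) := by
        intro Φ Ψ hΦ hΨ h hd
        obtain ⟨Θ, hΘ, hm⟩ := ((hΦ.comp₂ hκ hΨ Prod.mk).eventually_exists_iff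
          (fun p z => Lev.Mem z p.1 ∧ ¬ Lev.Mem z p.2)).1 hd
        have hx := (mem_lim_iff hκ hJ).2 ⟨Θ, hΘ, hm.mono fun _ hl => hl.1, rfl⟩
        rw [h] at hx
        obtain ⟨Θ', hΘ', hm', e⟩ := (mem_lim_iff hκ hJ).1 hx
        refine not_eventually_false hJ
          (((eventually_eq_of_lim_eq hκ hJ n hΘ hΘ' e).and hκ hJ (hm.and hκ hJ hm')).mono ?_)
        rintro lam ⟨e, ⟨-, h1⟩, h2⟩
        exact h1 (e ▸ h2)
      have np := hΦ.comp₂ hκ hΨ Prod.mk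
      -- If the nets are not eventually equal, then they eventually differ, by an element on one and
      -- the same side.
      by_contra hne
      replace hne := (np.eventually_not_iff hκ hJ (fun p => p.1 = p.2)).2 hne
      replace ha := (hΦ.eventually_not_iff hκ hJ Lev.IsAtom).2 ha
      replace hb := (hΨ.eventually_not_iff hκ hJ Lev.IsAtom).2 hb
      have hd := ((ha.and hκ hJ hb).and hκ hJ hne).mono
        fun _ hl => Lev.exists_mem_of_ne hl.1.1 hl.1.2 hl.2
      rcases (np.eventually_or_iff hκ hJ
        (fun p => ∃ z, Lev.Mem z p.1 ∧ ¬ Lev.Mem z p.2)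
        (fun p => ∃ z, Lev.Mem z p.2 ∧ ¬ Lev.Mem z p.1)).1 hd with hd | hd
      · exact key hΦ hΨ h hd
      · exact key hΨ hΦ h.symm hd

theorem lim_eq_iff (hκ : ℵ₀ ≤ κ) (hJ : IsLambdaLimit κ num J) {n : ℕ}
    {Φ Ψ : Finset (V 𝔸) → Lev E n} (hΦ : IsNet κ Φ) (hΨ : IsNet κ Ψ) :
    lim κ J n Φ = lim κ J n Ψ ↔ Eventually κ J (fun lam => Φ lam = Ψ lam) :=
  ⟨eventually_eq_of_lim_eq hκ hJ n hΦ hΨ, lim_congr hκ hJ n hΦ hΨ⟩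

theorem lim_mem_iff (hκ : ℵ₀ ≤ κ) (hJ : IsLambdaLimit κ num J) {n : ℕ}
    {Ψ : Finset (V 𝔸) → Lev E n} {Φ : Finset (V 𝔸) → Lev E (n + 1)} (hΨ : IsNet κ Ψ) :
    Lev.Mem (lim κ J n Ψ) (lim κ J (n + 1) Φ) ↔
      Eventually κ J (fun lam => Lev.Mem (Ψ lam) (Φ lam)) := by
  rw [mem_lim_iff hκ hJ]
  constructor
  · rintro ⟨Θ, hΘ, hm, e⟩
    refine (((lim_eq_iff hκ hJ hΨ hΘ).1 e).and hκ hJ hm).mono ?_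
    rintro lam ⟨e, hl⟩
    exact e ▸ hl
  · exact fun h => ⟨Ψ, hΨ, h, rfl⟩

end Ordered

/-! ### Limits in the superstructure -/

variable (κ J) in
/-- `x ∈ V(E)` is the `Λ`-limit of the net `Φ` in `V(E)`; the net has to take its values in a
single level. -/
def IsLim (Φ : Finset (V 𝔸) → V E) (x : V E) : Prop :=
  ∃ (n : ℕ) (Φ' : Finset (V 𝔸) → Lev E n), IsNet κ Φ' ∧ (∀ lam, Φ lam = V.mk n (Φ' lam)) ∧
    x = V.mk n (lim κ J n Φ')

theorem isLim_mk {n : ℕ} {Φ : Finset (V 𝔸) → Lev E n} (hΦ : IsNet κ Φ) :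
    IsLim κ J (fun lam => V.mk n (Φ lam)) (V.mk n (lim κ J n Φ)) :=
  ⟨n, Φ, hΦ, fun _ => rfl, rfl⟩

theorem IsLim.isNet {Φ : Finset (V 𝔸) → V E} {x : V E} (h : IsLim κ J Φ x) : IsNet κ Φ := by
  obtain ⟨n, Φ', hΦ', e, -⟩ := h
  exact funext e ▸ hΦ'.comp (V.mk n)

section Ordered

variable [LinearOrder E] [IsStrictOrderedRing E]

/-- A limit can be computed at every sufficiently high level. -/
theorem IsLim.exists_level (hκ : ℵ₀ ≤ κ) (hJ : IsLambdaLimit κ num J) {Φ : Finset (V 𝔸) → V E}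
    {x : V E} (h : IsLim κ J Φ x) :
    ∃ m, ∀ n, m ≤ n → ∃ Φ' : Finset (V 𝔸) → Lev E n, IsNet κ Φ' ∧
      Φ = (fun lam => V.mk n (Φ' lam)) ∧ x = V.mk n (lim κ J n Φ') := by
  obtain ⟨m, Φ', hΦ', e, rfl⟩ := h
  refine ⟨m, fun n hn => ⟨fun lam => liftLE E m n hn (Φ' lam), hΦ'.comp _, ?_, ?_⟩⟩
  · exact funext fun lam => (e lam).trans (V.mk_liftLE m n hn _).symm
  · rw [lim_liftLE hκ hJ m n hn hΦ', V.mk_liftLE]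

theorem IsLim.eq_iff (hκ : ℵ₀ ≤ κ) (hJ : IsLambdaLimit κ num J) {Φ Ψ : Finset (V 𝔸) → V E}
    {x y : V E} (hx : IsLim κ J Φ x) (hy : IsLim κ J Ψ y) :
    x = y ↔ Eventually κ J (fun lam => Φ lam = Ψ lam) := by
  obtain ⟨k, hk⟩ := hx.exists_level hκ hJ
  obtain ⟨l, hl⟩ := hy.exists_level hκ hJ
  obtain ⟨Φ', hΦ', rfl, rfl⟩ := hk _ (le_max_left k l)
  obtain ⟨Ψ', hΨ', rfl, rfl⟩ := hl _ (le_max_right k l)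
  simp only [(V.mk_injective _).eq_iff]
  exact lim_eq_iff hκ hJ hΦ' hΨ'

theorem IsLim.mem_iff (hκ : ℵ₀ ≤ κ) (hJ : IsLambdaLimit κ num J) {Φ Ψ : Finset (V 𝔸) → V E}
    {x y : V E} (hx : IsLim κ J Φ x) (hy : IsLim κ J Ψ y) :
    x ∈ y ↔ Eventually κ J (fun lam => Φ lam ∈ Ψ lam) := by
  obtain ⟨k, hk⟩ := hx.exists_level hκ hJ
  obtain ⟨l, hl⟩ := hy.exists_level hκ hJ
  obtain ⟨Φ', hΦ', rfl, rfl⟩ := hk _ (le_max_left k l)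
  obtain ⟨Ψ', hΨ', rfl, rfl⟩ := hl (max k l + 1) ((le_max_right k l).trans (Nat.le_succ _))
  simp only [V.mk_mem_mk]
  exact lim_mem_iff hκ hJ hΦ'

/-- The quantifier step of Łoś's theorem: every element of a limit is a limit, and the witnesses
of a bounded existential statement that holds eventually can be chosen as a net in one level. -/
theorem IsLim.exists_mem_iff (hκ : ℵ₀ ≤ κ) (hJ : IsLambdaLimit κ num J)
    {Φ : Finset (V 𝔸) → V E} {x : V E} (hx : IsLim κ J Φ x) {T : Type u}
    {φ : Finset (V 𝔸) → T} (hφ : IsNet κ φ) {P : T → V E → Prop} {Q : V E → Prop}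
    (hPQ : ∀ Ψ y, IsLim κ J Ψ y → (Q y ↔ Eventually κ J (fun lam => P (φ lam) (Ψ lam)))) :
    (∃ y, y ∈ x ∧ Q y) ↔ Eventually κ J (fun lam => ∃ z, z ∈ Φ lam ∧ P (φ lam) z) := by
  obtain ⟨m, hm⟩ := hx.exists_level hκ hJ
  obtain ⟨Φ', hΦ', rfl, rfl⟩ := hm (m + 1) (Nat.le_succ m)
  constructor
  · rintro ⟨y, hy, hQ⟩
    obtain ⟨a, rfl, ha⟩ := V.mem_mk.1 hy
    obtain ⟨Ψ, hΨ, h, rfl⟩ := (mem_lim_iff hκ hJ).1 ha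
    exact (h.and hκ hJ ((hPQ _ _ (isLim_mk hΨ)).1 hQ)).mono
      fun lam hl => ⟨V.mk m (Ψ lam), V.mk_mem_mk.2 hl.1, hl.2⟩
  · intro h
    have h' : Eventually κ J (fun lam => ∃ a : Lev E m,
        Lev.Mem a (Φ' lam) ∧ P (φ lam) (V.mk m a)) := by
      refine h.mono ?_
      rintro lam ⟨z, hz, hP⟩
      obtain ⟨a, rfl, ha⟩ := V.mem_mk.1 hz
      exact ⟨a, ha, hP⟩
    obtain ⟨Ψ, hΨ, h'⟩ := ((hΦ'.comp₂ hκ hφ Prod.mk).eventually_exists_iff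
      (fun p a => Lev.Mem a p.1 ∧ P p.2 (V.mk m a))).1 h'
    obtain ⟨h1, h2⟩ := (eventually_and_iff hκ hJ).1 h'
    exact ⟨V.mk m (lim κ J m Ψ), V.mk_mem_mk.2 ((lim_mem_iff hκ hJ hΨ).2 h1),
      (hPQ _ _ (isLim_mk hΨ)).2 h2⟩

/-! ### The theorem of Łoś -/

variable {ctr : E → E}

theorem isLim_star (hE : IsEuclidean κ E num ctr) (hJ : IsLambdaLimit κ num J) (x : V E) :
    IsLim κ J (fun _ => x) (star hE hJ x) := by
  induction x using Quotient.inductionOn with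
  | h p => exact isLim_mk (n := p.1) (IsNet.const hE.inaccessible.aleph0_lt.le p.2)

theorem isLim_val_map_star (hE : IsEuclidean κ E num ctr) (hJ : IsLambdaLimit κ num J) {n : ℕ}
    (t : ElemTerm (V E) n) {v : Finset (V 𝔸) → Fin n → V E} {w : Fin n → V E}
    (hw : ∀ i, IsLim κ J (fun lam => v lam i) (w i)) :
    IsLim κ J (fun lam => t.val (v lam)) ((t.map (star hE hJ)).val w) := by
  cases t with
  | const c => exact isLim_star hE hJ c
  | var i => exact hw i

/-- **Łoś's theorem** for elementary formulas: a formula whose constants are replaced by their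
`*`-transforms holds of the limits of some nets exactly if the original formula holds eventually
along these nets. -/
theorem holds_map_star_iff (hE : IsEuclidean κ E num ctr) (hJ : IsLambdaLimit κ num J) {n : ℕ}
    (φ : ElemFormula (V E) n) {v : Finset (V 𝔸) → Fin n → V E} {w : Fin n → V E}
    (hv : IsNet κ v) (hw : ∀ i, IsLim κ J (fun lam => v lam i) (w i)) :
    (φ.map (star hE hJ)).Holds w ↔ Eventually κ J (fun lam => φ.Holds (v lam)) := by
  have hκ : ℵ₀ ≤ κ := hE.inaccessible.aleph0_lt.le
  have hcons : ∀ {n : ℕ} {v : Finset (V 𝔸) → Fin n → V E} {w : Fin n → V E}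
      {Ψ : Finset (V 𝔸) → V E} {y : V E}, (∀ i, IsLim κ J (fun lam => v lam i) (w i)) →
      IsLim κ J Ψ y → ∀ i, IsLim κ J
        (fun lam => (Fin.cons (Ψ lam) (v lam) : Fin (n + 1) → V E) i)
        ((Fin.cons y w : Fin (n + 1) → V E) i) :=
    fun hw hΨ i => Fin.cases hΨ hw i
  have ncons : ∀ {n : ℕ} {v : Finset (V 𝔸) → Fin n → V E} {Ψ : Finset (V 𝔸) → V E} {y : V E},
      IsNet κ v → IsLim κ J Ψ y →
      IsNet κ (fun lam => (Fin.cons (Ψ lam) (v lam) : Fin (n + 1) → V E)) :=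
    fun {n} _ _ _ hv hy => hy.isNet.comp₂ hκ hv fun z u => (Fin.cons z u : Fin (n + 1) → V E)
  induction φ with
  | eq s t => exact (isLim_val_map_star hE hJ s hw).eq_iff hκ hJ (isLim_val_map_star hE hJ t hw)
  | mem s t => exact (isLim_val_map_star hE hJ s hw).mem_iff hκ hJ (isLim_val_map_star hE hJ t hw)
  | not φ ih => exact (not_congr (ih hv hw)).trans (hv.eventually_not_iff hκ hJ φ.Holds).symm
  | and φ ψ ih₁ ih₂ =>
    exact (and_congr (ih₁ hv hw) (ih₂ hv hw)).trans (eventually_and_iff hκ hJ).symm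
  | or φ ψ ih₁ ih₂ =>
    exact (or_congr (ih₁ hv hw) (ih₂ hv hw)).trans
      (hv.eventually_or_iff hκ hJ φ.Holds ψ.Holds).symm
  | imp φ ψ ih₁ ih₂ =>
    exact (imp_congr (ih₁ hv hw) (ih₂ hv hw)).trans
      (hv.eventually_imp_iff hκ hJ φ.Holds ψ.Holds).symm
  | ex t φ ih =>
    exact (isLim_val_map_star hE hJ t hw).exists_mem_iff hκ hJ hv
      (P := fun u z => φ.Holds (Fin.cons z u)) fun Ψ y hy =>
        ih (ncons hv hy) (hcons hw hy)
  | all t φ ih =>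
    -- The universal quantifier is the negation of an existential one.
    have h := (isLim_val_map_star hE hJ t hw).exists_mem_iff hκ hJ hv
      (P := fun u z => ¬ φ.Holds (Fin.cons z u))
      (Q := fun y => ¬ (φ.map (star hE hJ)).Holds (Fin.cons y w)) fun Ψ y hy =>
        (not_congr (ih (ncons hv hy) (hcons hw hy))).trans
          ((ncons hv hy).eventually_not_iff hκ hJ φ.Holds).symm
    have h' := (not_congr h).trans (hv.eventually_not_iff hκ hJ
      (fun u => ∃ z, z ∈ t.val u ∧ ¬ φ.Holds (Fin.cons z u))).symm
    simp only [not_exists, not_and, not_not] at h'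
    exact h'

theorem star_base (hE : IsEuclidean κ E num ctr) (hJ : IsLambdaLimit κ num J) :
    star hE hJ (V.base E) = V.base E := by
  have hκ : ℵ₀ ≤ κ := hE.inaccessible.aleph0_lt.le
  have hna : ¬ Eventually κ J
      (fun _ => Lev.IsAtom (Lev.ofSet (n := 0) (Set.univ : Set (Lev E 0)))) := by
    rw [eventually_const_iff hκ hJ]
    rintro ⟨a, ha⟩
    exact Lev.ofAtom_ne_ofSet a _ ha.symm
  change V.mk 1 (lim κ J 1 fun _ => Lev.ofSet (n := 0) Set.univ) = V.mk 1 (Lev.ofSet Set.univ)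
  rw [lim_of_not_atom hna]
  refine congrArg (fun s => V.mk 1 (Lev.ofSet s)) (Set.eq_univ_of_forall fun ξ => ?_)
  obtain ⟨φ, hφ, rfl⟩ := hJ.onto ξ
  exact ⟨φ, hφ, Eventually.of_forall hκ hJ fun _ => Lev.mem_ofSet.2 (Set.mem_univ _), rfl⟩

end Ordered

end Los

end EU

theorem mainTheorem10 {𝔸 : Type u} {κ : Cardinal.{u}} {E : Set 𝔸} [Field E] [LinearOrder E]
    [IsStrictOrderedRing E] {num : Set (EU.V 𝔸) → E} {ctr : E → E}
    {J : (Finset (EU.V 𝔸) → E) → E}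
    (hE : EU.IsEuclidean κ E num ctr) (hJ : EU.IsLambdaLimit κ num J) :
    EU.IsSuperstructureEmbedding (EU.star hE hJ) ∧ EU.LeibnizPrinciple (EU.star hE hJ) := by
  have hκ : ℵ₀ ≤ κ := hE.inaccessible.aleph0_lt.le
  refine ⟨⟨fun x y h => ?_, EU.star_base hE hJ, fun x y => ?_⟩, fun φ => ?_⟩
  · exact (EU.eventually_const_iff hκ hJ).1
      (((EU.isLim_star hE hJ x).eq_iff hκ hJ (EU.isLim_star hE hJ y)).1 h)
  · exact (EU.eventually_const_iff hκ hJ).symm.trans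
      ((EU.isLim_star hE hJ x).mem_iff hκ hJ (EU.isLim_star hE hJ y)).symm
  · exact (EU.eventually_const_iff hκ hJ).symm.trans
      (EU.holds_map_star_iff hE hJ φ (EU.IsNet.const hκ Fin.elim0) fun i => i.elim0).symm
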